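/- Let $n\ge 2$, let $S^{n-1}$ be the unit sphere of $\mathbb{R}^n$, and let $Q_{n,k}$ be the Gegenbauer polynomial of degree $k$ for $S^{n-1}$, normalized by $Q_{n,k}(1)=\dim \mathrm{Harm}_k(\mathbb{R}^n)$, where $\mathrm{Harm}_k(\mathbb{R}^n)$ is the space of real homogeneous harmonic polynomials of degree $k$ in $n$ variables. A spherical design of harmonic index $T\subset\mathbb{N}$ is a finite non-empty set $Y\subset S^{n-1}$ such that $\sum_{y\in Y}p(y)=0$ for every $k\in T$ and every $p\in\mathrm{Harm}_k(\mathbb{R}^n)$. For $T=\{8,6\}$ and $f_6\in\mathbb{R}$ put $L=Q_{n,8}+f_6Q_{n,6}$. There is no tight spherical design of harmonic index $\{8,6\}$ on $S^{n-1}$, for any $n\ge 2$, in both of the following senses. (1) There is no spherical design $Y$ of harmonic index $\{8,6\}$ on $S^{n-1}$ such that $|Y|=\dfrac{c+L(1)}{c}$ for some $f_6\in\mathbb{R}$ for which $L$ has minimum value $-c$ on $[-1,1]$ and attains it at exactly two non-negative points of $[-1,1]$. (2) There is no spherical design $Y$ of harmonic index $\{8,6\}$ on $S^{n-1}$ such that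 $|Y|=\dfrac{c+L(1)}{c}$ for some real $f_6, c$ for which the polynomial identity $$Q_{n,8}(x)+f_6\,Q_{n,6}(x)=a\,(x^2-\alpha^2)^2(x^2-\beta^2)^2-c$$ holds with some $a\in\mathbb{R}$ and some $\alpha,\beta\in\mathbb{C}$. -/

import Mathlib

open Polynomial

noncomputable section

namespace HarmonicIndex

/-- The Gegenbauer polynomial `Q_{n,k}` on the sphere of `ℝⁿ`, `n ≥ 2`, normalized by
`Q_{n,k}(1) = dim Harm_k(ℝⁿ)`. With `μ_k = k / (n + 2k - 2)` it satisfies `Q_{n,0} = 1`,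
`Q_{n,1} = n x` and `μ_{k+2} Q_{n,k+2} = x Q_{n,k+1} - (1 - μ_k) Q_{n,k}`. (For `n = 2` and
`k = 0` the number `μ_0` is read as `0`, which is the value that gives `Q_{2,2} = 2 (2 x ^ 2 - 1)`.) -/
def gegenbauer (n : ℕ) : ℕ → ℝ[X]
  | 0 => 1
  | 1 => C (n : ℝ) * X
  | k + 2 =>
      C (((n : ℝ) + 2 * k + 2) / ((k : ℝ) + 2)) *
        (X * gegenbauer n (k + 1) - C (1 - (k : ℝ) / ((n : ℝ) + 2 * k - 2)) * gegenbauer n k)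

/-- The Laplacian of a real polynomial in `n` variables. -/
def laplacian {n : ℕ} (p : MvPolynomial (Fin n) ℝ) : MvPolynomial (Fin n) ℝ :=
  ∑ i, MvPolynomial.pderiv i (MvPolynomial.pderiv i p)

/-- `Y` is a spherical design of harmonic index `T` in the unit sphere of `ℝⁿ`: a non-empty finite
set of unit vectors over which every homogeneous harmonic polynomial of degree in `T` sums to `0`. -/
structure IsDesign {n : ℕ} (T : Finset ℕ) (Y : Finset (EuclideanSpace ℝ (Fin n))) : Prop where
  nonempty : Y.Nonempty
  unit : ∀ y ∈ Y, ‖y‖ = 1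
  sum_eq_zero : ∀ k ∈ T, ∀ p : MvPolynomial (Fin n) ℝ, p.IsHomogeneous k → laplacian p = 0 →
    ∑ y ∈ Y, MvPolynomial.eval (fun i => y i) p = 0

/-- The linear combination `∑_{t ∈ T} f_t Q_{n,t}`. -/
def combination (n : ℕ) (T : Finset ℕ) (f : ℕ → ℝ) : ℝ[X] :=
  ∑ t ∈ T, C (f t) * gegenbauer n t

/-- The Fisher type bound `F(1) / c` obtained from `F = c + L`. -/
def fisherBound (L : ℝ[X]) (c : ℝ) : ℝ :=
  (c + L.eval 1) / c

/-- `L = ∑_{t ∈ T} f_t Q_{n,t}`, with coefficient `1` at the largest index of `T`, has minimum value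
`-c` on `[-1, 1]`, and attains it at exactly `|T|` non-negative points. -/
structure IsExtremal (n : ℕ) (T : Finset ℕ) (f : ℕ → ℝ) (c : ℝ) : Prop where
  leading : ∀ t ∈ T, (∀ s ∈ T, s ≤ t) → f t = 1
  isLeast : IsLeast ((fun x => (combination n T f).eval x) '' Set.Icc (-1) 1) (-c)
  ncard_eq : {x : ℝ | x ∈ Set.Icc 0 1 ∧ (combination n T f).eval x = -c}.ncard = T.card

/-- `Y` is a tight spherical design of harmonic index `T`: its size equals the Fisher type bound
given by an extremal combination. Uniqueness of that combination is not demanded, so that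
a set that is tight for any one of them counts. -/
def IsTight {n : ℕ} (T : Finset ℕ) (Y : Finset (EuclideanSpace ℝ (Fin n))) : Prop :=
  IsDesign T Y ∧
    ∃ (f : ℕ → ℝ) (c : ℝ), IsExtremal n T f c ∧ (Y.card : ℝ) = fisherBound (combination n T f) c

/-- `Q_{n,8} + f₆ Q_{n,6}`. -/
def combination86 (n : ℕ) (f₆ : ℝ) : ℝ[X] :=
  gegenbauer n 8 + C f₆ * gegenbauer n 6

/-- The polynomial identity `Q_{n,8} + f₆ Q_{n,6} = a (x² - α²)² (x² - β²)² - c` holds with real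
`f₆`, `a`, `c`. The numbers `α`, `β` may be complex (so that `α²` or `β²` may be negative). -/
def HasSquareForm86 (n : ℕ) (f₆ c : ℝ) : Prop :=
  ∃ (a : ℝ) (α β : ℂ),
    (combination86 n f₆).map (algebraMap ℝ ℂ) =
      C (a : ℂ) * (X ^ 2 - C (α ^ 2)) ^ 2 * (X ^ 2 - C (β ^ 2)) ^ 2 - C (c : ℂ)

/-- `Y` is a spherical design of harmonic index `{8, 6}` whose size equals the bound
`b = F(1) / c` computed from the square form of `F = c + Q_{n,8} + f₆ Q_{n,6}`. -/
def IsSquareFormTight86 {n : ℕ} (Y : Finset (EuclideanSpace ℝ (Fin n))) : Prop :=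
  IsDesign {8, 6} Y ∧
    ∃ f₆ c : ℝ, HasSquareForm86 n f₆ c ∧ (Y.card : ℝ) = fisherBound (combination86 n f₆) c

end HarmonicIndex

end

/-! Divide by the leading coefficient of `Q_{n,8}` and put `s = x²`. Both notions of tightness lead
to `P₈ + g P₆ + c = (s² + u s + v)²` with `|Y| c = (1 + u + v)²`. For a fixed `x ∈ Y`, zonal
harmonics give `∑ P₆(⟨x,y⟩²) = ∑ P₈(⟨x,y⟩²) = 0`, so summing the square over `Y` yields `|Y| c`,
which the term `y = x` already exhausts. Hence every other `⟨x,y⟩²` is a root of `s² + u s + v`.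

Comparing coefficients expresses `v` through `u` and leaves a cubic for `u` (`cubic_eq`). If `4.4 ≤
-u (n + 5) ≤ 4.58`, then `v < 0` and the only non-negative root `s` is trapped in a short interval
(`root_mem_Icc`). On it `P₈ - ρ P₆` is positive, where `ρ = P₈(1) / P₆(1)` (`monic8_sub_pos`). This
combination vanishes at `s = 1` and sums to zero over `Y`, a contradiction.

The lower bound on `-u (n + 5)` always holds, the upper one for `n ≥ 5`. The remaining roots of the
cubic, for `n = 2, 3, 4`, give a non-integral or too small `|Y|`, or `|Y| = 2`, which the degree 6
condition excludes. -/

namespace HarmonicIndex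

/-! ### Zonal polynomials and their Laplacian -/

section Zonal

variable {n : ℕ}

/-- The linear form `⟨x, ·⟩` as a polynomial. -/
noncomputable def linearForm (x : EuclideanSpace ℝ (Fin n)) : MvPolynomial (Fin n) ℝ :=
  ∑ i, MvPolynomial.C (x i) * MvPolynomial.X i

/-- The squared norm as a polynomial. -/
noncomputable def normSqForm (n : ℕ) : MvPolynomial (Fin n) ℝ :=
  ∑ i, MvPolynomial.X i ^ 2

lemma pderiv_linearForm (x : EuclideanSpace ℝ (Fin n)) (i : Fin n) :
    MvPolynomial.pderiv i (linearForm x) = MvPolynomial.C (x i) := by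
  simp [linearForm, MvPolynomial.pderiv_X, Pi.single_apply]

lemma pderiv_normSqForm (i : Fin n) :
    MvPolynomial.pderiv i (normSqForm n) = 2 * MvPolynomial.X i := by
  simp [normSqForm, MvPolynomial.pderiv_X, Pi.single_apply, Derivation.leibniz_pow]

lemma sum_C_mul_C {x : EuclideanSpace ℝ (Fin n)} (hx : ‖x‖ = 1) :
    ∑ i, (MvPolynomial.C (x i) * MvPolynomial.C (x i) : MvPolynomial (Fin n) ℝ) = 1 := by
  have h : ∑ i, x i * x i = 1 := by
    have := EuclideanSpace.real_norm_sq_eq x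
    rw [hx] at this
    simpa [sq] using this.symm
  rw [← MvPolynomial.C_1, ← h, map_sum]
  simp

lemma laplacian_add (p q : MvPolynomial (Fin n) ℝ) :
    laplacian (p + q) = laplacian p + laplacian q := by
  simp [laplacian, Finset.sum_add_distrib]

lemma laplacian_C_mul (a : ℝ) (p : MvPolynomial (Fin n) ℝ) :
    laplacian (MvPolynomial.C a * p) = MvPolynomial.C a * laplacian p := by
  simp [laplacian, Finset.mul_sum]

/-- For `l = ⟨x, ·⟩` and `r = |·|²` one has `|∇l|² = 1`, `∇l · ∇r = 2l`, `|∇r|² = 4r` and `Δr = 2n`.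
The truncated exponents do no harm, since their coefficients vanish when truncation occurs. -/
lemma laplacian_linearForm_pow_mul_normSqForm_pow {x : EuclideanSpace ℝ (Fin n)} (hx : ‖x‖ = 1)
    (a b : ℕ) :
    laplacian (linearForm x ^ a * normSqForm n ^ b) =
      (a * (a - 1 : ℕ) : MvPolynomial (Fin n) ℝ) * linearForm x ^ (a - 1 - 1) * normSqForm n ^ b
      + 4 * a * b * linearForm x ^ (a - 1) * normSqForm n ^ (b - 1) * linearForm x
      + 4 * b * (b - 1 : ℕ) * linearForm x ^ a * normSqForm n ^ (b - 1 - 1) * normSqForm n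
      + 2 * b * n * linearForm x ^ a * normSqForm n ^ (b - 1) := by
  set l := linearForm x with hl
  set r := normSqForm n with hr
  have key : ∀ i, MvPolynomial.pderiv i (MvPolynomial.pderiv i (l ^ a * r ^ b)) =
      (a * (a - 1 : ℕ) : MvPolynomial (Fin n) ℝ) * l ^ (a - 1 - 1) * r ^ b *
        (MvPolynomial.C (x i) * MvPolynomial.C (x i))
      + (4 * a * b : MvPolynomial (Fin n) ℝ) * l ^ (a - 1) * r ^ (b - 1) *
        (MvPolynomial.C (x i) * MvPolynomial.X i)
      + (4 * b * (b - 1 : ℕ) : MvPolynomial (Fin n) ℝ) * l ^ a * r ^ (b - 1 - 1) *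
        (MvPolynomial.X i ^ 2)
      + (2 * b : MvPolynomial (Fin n) ℝ) * l ^ a * r ^ (b - 1) := by
    intro i
    have h2 : MvPolynomial.pderiv i (2 : MvPolynomial (Fin n) ℝ) = 0 :=
      (MvPolynomial.pderiv i).map_natCast 2
    have h1 : MvPolynomial.pderiv i (MvPolynomial.C (x i)) = 0 := MvPolynomial.pderiv_C
    simp only [MvPolynomial.pderiv_mul, MvPolynomial.pderiv_pow, pderiv_linearForm, h1, h2, hl, hr,
      pderiv_normSqForm, MvPolynomial.pderiv_X_self, Derivation.map_natCast, map_add]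
    ring
  simp only [laplacian, key]
  rw [Finset.sum_add_distrib,
    Finset.sum_add_distrib, Finset.sum_add_distrib, ← Finset.mul_sum, ← Finset.mul_sum,
    ← Finset.mul_sum, sum_C_mul_C hx]
  change _ + _ * linearForm x + _ * normSqForm n + _ = _
  rw [Finset.sum_const, Finset.card_univ, Fintype.card_fin, nsmul_eq_mul]
  ring

lemma eval_linearForm (x y : EuclideanSpace ℝ (Fin n)) :
    MvPolynomial.eval (fun i => y i) (linearForm x) = inner ℝ x y := by
  simp [linearForm, PiLp.inner_apply, mul_comm]

lemma eval_normSqForm {y : EuclideanSpace ℝ (Fin n)} (hy : ‖y‖ = 1) :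
    MvPolynomial.eval (fun i => y i) (normSqForm n) = 1 := by
  have := EuclideanSpace.real_norm_sq_eq y
  rw [hy] at this
  simpa [normSqForm] using this.symm

lemma isHomogeneous_linearForm_pow_mul (x : EuclideanSpace ℝ (Fin n)) (e : ℝ) {a b k : ℕ}
    (h : a + 2 * b = k) :
    (MvPolynomial.C e * (linearForm x ^ a * normSqForm n ^ b)).IsHomogeneous k := by
  have hl : (linearForm x).IsHomogeneous 1 := by
    refine MvPolynomial.IsHomogeneous.sum _ _ _ fun i _ => ?_
    simpa using (MvPolynomial.isHomogeneous_C (Fin n) (x i)).mul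
      (MvPolynomial.isHomogeneous_X ℝ i)
  have hr : (normSqForm n).IsHomogeneous 2 := by
    refine MvPolynomial.IsHomogeneous.sum _ _ _ fun i _ => ?_
    simpa using (MvPolynomial.isHomogeneous_X ℝ i).pow 2
  have := (MvPolynomial.isHomogeneous_C (Fin n) e).mul ((hl.pow a).mul (hr.pow b))
  convert this using 1
  omega

end Zonal

/-- `P₆(s)`: the monic multiple of `Q_{n,6}` as a polynomial in `s = x²`. -/
noncomputable def monic6 (m s : ℝ) : ℝ :=
  s ^ 3 - 15 / (m + 8) * s ^ 2 + 45 / ((m + 8) * (m + 6)) * s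
    - 15 / ((m + 8) * (m + 6) * (m + 4))

/-- `P₈(s)`: the monic multiple of `Q_{n,8}` as a polynomial in `s = x²`. -/
noncomputable def monic8 (m s : ℝ) : ℝ :=
  s ^ 4 - 28 / (m + 12) * s ^ 3 + 210 / ((m + 12) * (m + 10)) * s ^ 2
    - 420 / ((m + 12) * (m + 10) * (m + 8)) * s
    + 105 / ((m + 12) * (m + 10) * (m + 8) * (m + 6))

/-! ### Vanishing sums of `P₆` and `P₈` over a design -/

section Sums

variable {n : ℕ} {T : Finset ℕ} {Y : Finset (EuclideanSpace ℝ (Fin n))}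

lemma IsDesign.sum_monic6 (h : IsDesign T Y) (h6 : 6 ∈ T) {x : EuclideanSpace ℝ (Fin n)}
    (hx : ‖x‖ = 1) : ∑ y ∈ Y, monic6 n (inner ℝ x y ^ 2) = 0 := by
  have hm : (0 : ℝ) ≤ n := n.cast_nonneg
  have hom : ∀ (e : ℝ) {a b : ℕ}, a + 2 * b = 6 → _ :=
    fun e {a b} hab => isHomogeneous_linearForm_pow_mul x e hab
  have := h.sum_eq_zero 6 h6
    (MvPolynomial.C 1 * (linearForm x ^ 6 * normSqForm n ^ 0)
      + MvPolynomial.C (-15 / ((n : ℝ) + 8)) * (linearForm x ^ 4 * normSqForm n ^ 1)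
      + MvPolynomial.C (45 / (((n : ℝ) + 8) * (n + 6))) * (linearForm x ^ 2 * normSqForm n ^ 2)
      + MvPolynomial.C (-15 / (((n : ℝ) + 8) * (n + 6) * (n + 4))) *
          (linearForm x ^ 0 * normSqForm n ^ 3))
    ((((hom _ rfl).add (hom _ rfl)).add (hom _ rfl)).add (hom _ rfl)) (by
      simp only [laplacian_add, laplacian_C_mul, laplacian_linearForm_pow_mul_normSqForm_pow hx]
      -- Harmonicity means that the coefficients of `l⁴`, `l² r`, `r²` in the Laplacian vanish.
      have e1 : (30 : ℝ) + (-15 / ((n : ℝ) + 8)) * (16 + 2 * n) = 0 := by field_simp; ring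
      have e2 : (-15 / ((n : ℝ) + 8)) * 12 +
        (45 / (((n : ℝ) + 8) * (n + 6))) * (24 + 4 * n) = 0 := by field_simp; ring
      have e3 : (45 / (((n : ℝ) + 8) * (n + 6))) * 2 +
        (-15 / (((n : ℝ) + 8) * (n + 6) * (n + 4))) * (24 + 6 * n) = 0 := by field_simp; ring
      apply_fun (MvPolynomial.C : ℝ → MvPolynomial (Fin n) ℝ) at e1 e2 e3
      simp only [map_add, map_mul, map_natCast, map_ofNat, map_zero] at e1 e2 e3
      push_cast
      norm_num
      linear_combination linearForm x ^ 4 * e1 + linearForm x ^ 2 * normSqForm n * e2 +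
        normSqForm n ^ 2 * e3)
  rw [← this]
  refine Finset.sum_congr rfl fun y hy => ?_
  simp only [map_add, map_mul, map_pow, MvPolynomial.eval_C, eval_linearForm,
    eval_normSqForm (h.unit y hy), monic6]
  ring

lemma IsDesign.sum_monic8 (h : IsDesign T Y) (h8 : 8 ∈ T) {x : EuclideanSpace ℝ (Fin n)}
    (hx : ‖x‖ = 1) : ∑ y ∈ Y, monic8 n (inner ℝ x y ^ 2) = 0 := by
  have hm : (0 : ℝ) ≤ n := n.cast_nonneg
  have hom : ∀ (e : ℝ) {a b : ℕ}, a + 2 * b = 8 → _ :=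
    fun e {a b} hab => isHomogeneous_linearForm_pow_mul x e hab
  have := h.sum_eq_zero 8 h8
    (MvPolynomial.C 1 * (linearForm x ^ 8 * normSqForm n ^ 0)
      + MvPolynomial.C (-28 / ((n : ℝ) + 12)) * (linearForm x ^ 6 * normSqForm n ^ 1)
      + MvPolynomial.C (210 / (((n : ℝ) + 12) * (n + 10))) * (linearForm x ^ 4 * normSqForm n ^ 2)
      + MvPolynomial.C (-420 / (((n : ℝ) + 12) * (n + 10) * (n + 8))) *
          (linearForm x ^ 2 * normSqForm n ^ 3)
      + MvPolynomial.C (105 / (((n : ℝ) + 12) * (n + 10) * (n + 8) * (n + 6))) *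
          (linearForm x ^ 0 * normSqForm n ^ 4))
    (((((hom _ rfl).add (hom _ rfl)).add (hom _ rfl)).add (hom _ rfl)).add (hom _ rfl)) (by
      simp only [laplacian_add, laplacian_C_mul, laplacian_linearForm_pow_mul_normSqForm_pow hx]
      have e1 : (56 : ℝ) + (-28 / ((n : ℝ) + 12)) * (24 + 2 * n) = 0 := by field_simp; ring
      have e2 : (-28 / ((n : ℝ) + 12)) * 30 +
        (210 / (((n : ℝ) + 12) * (n + 10))) * (40 + 4 * n) = 0 := by field_simp; ring
      have e3 : (210 / (((n : ℝ) + 12) * (n + 10))) * 12 +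
        (-420 / (((n : ℝ) + 12) * (n + 10) * (n + 8))) * (48 + 6 * n) = 0 := by field_simp; ring
      have e4 : (-420 / (((n : ℝ) + 12) * (n + 10) * (n + 8))) * 2 +
        (105 / (((n : ℝ) + 12) * (n + 10) * (n + 8) * (n + 6))) * (48 + 8 * n) = 0 := by
          field_simp; ring
      apply_fun (MvPolynomial.C : ℝ → MvPolynomial (Fin n) ℝ) at e1 e2 e3 e4
      simp only [map_add, map_mul, map_natCast, map_ofNat, map_zero] at e1 e2 e3 e4
      push_cast
      norm_num
      linear_combination linearForm x ^ 6 * e1 + linearForm x ^ 4 * normSqForm n * e2 +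
        linearForm x ^ 2 * normSqForm n ^ 2 * e3 + normSqForm n ^ 3 * e4)
  rw [← this]
  refine Finset.sum_congr rfl fun y hy => ?_
  simp only [map_add, map_mul, map_pow, MvPolynomial.eval_C, eval_linearForm,
    eval_normSqForm (h.unit y hy), monic8]
  ring

end Sums

/-- Leading coefficient of `Q_{n,6}`. -/
noncomputable def leading6 (m : ℝ) : ℝ :=
  m * (m + 2) * (m + 4) * (m + 6) * (m + 8) * (m + 10) / 720

/-- Leading coefficient of `Q_{n,8}`. -/
noncomputable def leading8 (m : ℝ) : ℝ :=
  m * (m + 2) * (m + 4) * (m + 6) * (m + 8) * (m + 10) * (m + 12) * (m + 14) / 40320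

lemma eval_gegenbauer_six_eight {n : ℕ} (hn : 2 ≤ n) (x : ℝ) :
    (gegenbauer n 6).eval x = leading6 n * monic6 n (x ^ 2) ∧
      (gegenbauer n 8).eval x = leading8 n * monic8 n (x ^ 2) := by
  have hm : (2 : ℝ) ≤ n := by exact_mod_cast hn
  have hr : ∀ k : ℕ, (gegenbauer n (k + 2)).eval x = (((n : ℝ) + 2 * k + 2) / ((k : ℝ) + 2)) *
      (x * (gegenbauer n (k + 1)).eval x -
        (1 - (k : ℝ) / ((n : ℝ) + 2 * k - 2)) * (gegenbauer n k).eval x) := fun k => by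
    rw [gegenbauer]; simp
  have h0 : (gegenbauer n 0).eval x = 1 := by rw [gegenbauer]; simp
  have h1 : (gegenbauer n 1).eval x = n * x := by rw [gegenbauer]; simp
  have f0 : (n : ℝ) + 2 * (1 : ℕ) - 2 = n := by push_cast; ring
  have f2 : (n : ℝ) + 2 * (2 : ℕ) - 2 = n + 2 := by push_cast; ring
  have f3 : (n : ℝ) + 2 * (3 : ℕ) - 2 = n + 4 := by push_cast; ring
  have f4 : (n : ℝ) + 2 * (4 : ℕ) - 2 = n + 6 := by push_cast; ring
  have f5 : (n : ℝ) + 2 * (5 : ℕ) - 2 = n + 8 := by push_cast; ring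
  have f6 : (n : ℝ) + 2 * (6 : ℕ) - 2 = n + 10 := by push_cast; ring
  -- At `n = 2` the recursion contains `0 / 0`, which is `0` as intended.
  have h2 : (gegenbauer n 2).eval x = (n + 2) / 2 * (n * x ^ 2 - 1) := by
    rw [hr 0, h1, h0]; push_cast; field_simp; ring
  have h3 : (gegenbauer n 3).eval x = n * (n + 4) / 6 * ((n + 2) * x ^ 3 - 3 * x) := by
    rw [hr 1, h2, h1, f0]; push_cast; field_simp; ring
  have h4 : (gegenbauer n 4).eval x =
      n * (n + 6) / 24 * ((n + 2) * (n + 4) * x ^ 4 - 6 * (n + 2) * x ^ 2 + 3) := by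
    rw [hr 2, h3, h2, f2]; push_cast; field_simp; ring
  have h5 : (gegenbauer n 5).eval x = n * (n + 2) * (n + 8) / 120 *
      ((n + 4) * (n + 6) * x ^ 5 - 10 * (n + 4) * x ^ 3 + 15 * x) := by
    rw [hr 3, h4, h3, f3]; push_cast; field_simp; ring
  have h6 : (gegenbauer n 6).eval x = leading6 n * monic6 n (x ^ 2) := by
    rw [hr 4, h5, h4, f4, leading6, monic6]; push_cast; field_simp; ring
  have h7 : (gegenbauer n 7).eval x = n * (n + 2) * (n + 4) * (n + 12) / 5040 *
      ((n + 6) * (n + 8) * (n + 10) * x ^ 7 - 21 * (n + 6) * (n + 8) * x ^ 5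
        + 105 * (n + 6) * x ^ 3 - 105 * x) := by
    rw [hr 5, h6, h5, f5, leading6, monic6]; push_cast; field_simp; ring
  refine ⟨h6, ?_⟩
  rw [hr 6, h7, h6, f6, leading6, monic6, leading8, monic8]; push_cast; field_simp; ring

/-! ### The square identity and the cubic for `u` -/

/-- `P₈ + g P₆ + c = (s² + u s + v)²`, coefficient by coefficient. -/
structure IsSquare86 (m g c u v : ℝ) : Prop where
  coeff3 : -28 / (m + 12) + g = 2 * u
  coeff2 : 210 / ((m + 12) * (m + 10)) - 15 / (m + 8) * g = u ^ 2 + 2 * v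
  coeff1 : -420 / ((m + 12) * (m + 10) * (m + 8)) + 45 / ((m + 8) * (m + 6)) * g = 2 * u * v
  coeff0 : 105 / ((m + 12) * (m + 10) * (m + 8) * (m + 6))
    - 15 / ((m + 8) * (m + 6) * (m + 4)) * g + c = v ^ 2

namespace IsSquare86

variable {m g c u v : ℝ}

lemma eval_eq (h : IsSquare86 m g c u v) (s : ℝ) :
    monic8 m s + g * monic6 m s + c = (s ^ 2 + u * s + v) ^ 2 := by
  obtain ⟨h3, h2, h1, h0⟩ := h
  rw [monic8, monic6]
  linear_combination s ^ 3 * h3 + s ^ 2 * h2 + s * h1 + h0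

lemma const_eq (h : IsSquare86 m g c u v) (hm : 2 ≤ m) :
    2 * v * ((m + 8) * (m + 10)) =
      -210 - 30 * (m + 10) * u - (m + 8) * (m + 10) * u ^ 2 := by
  have hg : g = 2 * u + 28 / (m + 12) := by linear_combination h.coeff3
  have h2 := h.coeff2
  rw [hg] at h2
  have : 2 * v = 210 / ((m + 12) * (m + 10)) - 15 / (m + 8) * (2 * u + 28 / (m + 12)) - u ^ 2 := by
    linear_combination -h2
  rw [this]
  field_simp
  ring

lemma cubic_eq (h : IsSquare86 m g c u v) (hm : 2 ≤ m) :
    (m + 6) * (m + 8) * (m + 10) * u ^ 3 + 30 * (m + 6) * (m + 10) * u ^ 2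
      + (300 * m + 2160) * u + 840 = 0 := by
  have hg : g = 2 * u + 28 / (m + 12) := by linear_combination h.coeff3
  have hv := h.const_eq hm
  have h1 := h.coeff1
  rw [hg] at h1
  have h1' : (-420 / ((m + 12) * (m + 10) * (m + 8))
      + 45 / ((m + 8) * (m + 6)) * (2 * u + 28 / (m + 12))) * ((m + 6) * (m + 8) * (m + 10)) =
      840 + 90 * (m + 10) * u := by
    field_simp
    ring
  rw [h1] at h1'
  linear_combination -h1' + u * (m + 6) * hv

end IsSquare86

/-! ### Locating `u` and the inner products -/

/-- As `m → ∞` the cubic for `w = -u m` tends to `(w - 10)³ + 160 = 0`, with real root `10 - ∛160 ≈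
4.571`. Here and in the similar estimates below, shifting the variables to be non-negative makes all
coefficients positive. -/
lemma neg_mul_add_five_ge {m u : ℝ} (hm : 2 ≤ m)
    (hu : (m + 6) * (m + 8) * (m + 10) * u ^ 3 + 30 * (m + 6) * (m + 10) * u ^ 2
      + (300 * m + 2160) * u + 840 = 0) : 4.4 ≤ -u * (m + 5) := by
  by_contra hlt
  obtain ⟨d, hd⟩ : ∃ d, d = 4.4 - -u * (m + 5) := ⟨_, rfl⟩
  obtain ⟨p, hp⟩ : ∃ p, p = m - 2 := ⟨_, rfl⟩
  have hd0 : 0 ≤ d := by linarith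
  have hp0 : 0 ≤ p := by linarith
  have hm' : m = p + 2 := by linarith
  have hw : u * (m + 5) = d - 4.4 := by linarith
  have h0 : (m + 6) * (m + 8) * (m + 10) * (d - 4.4) ^ 3
      + 30 * (m + 6) * (m + 10) * (m + 5) * (d - 4.4) ^ 2
      + (300 * m + 2160) * (m + 5) ^ 2 * (d - 4.4) + 840 * (m + 5) ^ 3 = 0 := by
    rw [← hw]
    linear_combination (m + 5) ^ 3 * hu
  rw [hm'] at h0
  have hpos : 0 < (p + 2 + 6) * (p + 2 + 8) * (p + 2 + 10) * (d - 4.4) ^ 3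
      + 30 * (p + 2 + 6) * (p + 2 + 10) * (p + 2 + 5) * (d - 4.4) ^ 2
      + (300 * (p + 2) + 2160) * (p + 2 + 5) ^ 2 * (d - 4.4) + 840 * (p + 2 + 5) ^ 3 := by
    ring_nf
    positivity
  linarith

lemma neg_mul_add_five_le {m u : ℝ} (hm : 5 ≤ m)
    (hu : (m + 6) * (m + 8) * (m + 10) * u ^ 3 + 30 * (m + 6) * (m + 10) * u ^ 2
      + (300 * m + 2160) * u + 840 = 0) : -u * (m + 5) ≤ 4.58 := by
  by_contra hlt
  obtain ⟨e, he⟩ : ∃ e, e = -u * (m + 5) - 4.58 := ⟨_, rfl⟩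
  obtain ⟨p, hp⟩ : ∃ p, p = m - 5 := ⟨_, rfl⟩
  have he0 : 0 ≤ e := by linarith
  have hp0 : 0 ≤ p := by linarith
  have hm' : m = p + 5 := by linarith
  have hw : -u * (m + 5) = e + 4.58 := by linarith
  -- Taylor coefficients, up to sign, of the cubic at `4.58`: the constant `c0` is positive and the
  -- remaining quadratic factor has negative discriminant.
  obtain ⟨c3, h3⟩ : ∃ a, a = (p + 11) * (p + 13) * (p + 15) := ⟨_, rfl⟩
  obtain ⟨c2, h2⟩ : ∃ a, a = 30 * (p + 11) * (p + 15) * (p + 10) - 13.74 * c3 := ⟨_, rfl⟩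
  obtain ⟨c1, h1⟩ : ∃ a, a = (300 * p + 3660) * (p + 10) ^ 2
    - 274.8 * (p + 11) * (p + 15) * (p + 10) + 62.9292 * c3 := ⟨_, rfl⟩
  obtain ⟨c0, h0⟩ : ∃ a, a = c3 * 4.58 ^ 3 - 30 * (p + 11) * (p + 15) * (p + 10) * 4.58 ^ 2
    + (300 * p + 3660) * (p + 10) ^ 2 * 4.58 - 840 * (p + 10) ^ 3 := ⟨_, rfl⟩
  have hH : c0 + e * (c1 - c2 * e + c3 * e ^ 2) = 0 := by
    have : (m + 6) * (m + 8) * (m + 10) * (-u * (m + 5)) ^ 3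
      - 30 * (m + 6) * (m + 10) * (m + 5) * (-u * (m + 5)) ^ 2
      + (300 * m + 2160) * (m + 5) ^ 2 * (-u * (m + 5)) - 840 * (m + 5) ^ 3 = 0 := by
      linear_combination -(m + 5) ^ 3 * hu
    rw [hw, hm'] at this
    rw [h0, h1, h2, h3]
    linear_combination this
  have p3 : 0 < c3 := by rw [h3]; positivity
  have p0 : 0 < c0 := by rw [h0, h3]; ring_nf; positivity
  have pd : 0 < 4 * c1 * c3 - c2 ^ 2 := by rw [h1, h2, h3]; ring_nf; positivity
  have pq : 0 < c1 - c2 * e + c3 * e ^ 2 := by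
    have : 0 < 4 * c3 * (c1 - c2 * e + c3 * e ^ 2) := by nlinarith [sq_nonneg (2 * c3 * e - c2)]
    exact pos_of_mul_pos_right this (by positivity)
  nlinarith [mul_nonneg he0 pq.le]

/-- The value at `s = σ / (m + 10)` of `2 (s² + u s + v)`, with `u = -w / (m + 5)`,
cleared of denominators. -/
noncomputable def clearedQuadratic (m w σ : ℝ) : ℝ :=
  2 * σ ^ 2 * (m + 8) * (m + 5) ^ 2 - 2 * w * σ * (m + 8) * (m + 10) * (m + 5)
    - 210 * (m + 10) * (m + 5) ^ 2 + 30 * (m + 10) ^ 2 * (m + 5) * w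
    - (m + 8) * (m + 10) ^ 2 * w ^ 2

lemma clearedQuadratic_eq {m u v : ℝ} (hm : 2 ≤ m)
    (hv : 2 * v * ((m + 8) * (m + 10)) =
      -210 - 30 * (m + 10) * u - (m + 8) * (m + 10) * u ^ 2) (σ : ℝ) :
    clearedQuadratic m (-u * (m + 5)) σ = 2 * (m + 8) * (m + 10) ^ 2 * (m + 5) ^ 2 *
      ((σ / (m + 10)) ^ 2 + u * (σ / (m + 10)) + v) := by
  have hv' : v = (-210 - 30 * (m + 10) * u - (m + 8) * (m + 10) * u ^ 2) /
    (2 * ((m + 8) * (m + 10))) := by rw [← hv]; field_simp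
  rw [hv', clearedQuadratic]
  field_simp
  ring

lemma clearedQuadratic_neg {p d : ℝ} (hp0 : 0 ≤ p) (hd1 : d ≤ 1) :
    clearedQuadratic (p + 2) (4.4 + 0.18 * d) 9.4 < 0 := by
  rw [clearedQuadratic]
  linarith [mul_nonneg hp0 (sub_nonneg.2 hd1), mul_nonneg (pow_nonneg hp0 2) (sub_nonneg.2 hd1),
    mul_nonneg (pow_nonneg hp0 3) (sub_nonneg.2 hd1), mul_nonneg hp0 (sq_nonneg d),
    mul_nonneg (pow_nonneg hp0 2) (sq_nonneg d), mul_nonneg (pow_nonneg hp0 3) (sq_nonneg d),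
    pow_nonneg hp0 2, pow_nonneg hp0 3, sq_nonneg d]

/-- The expression is concave in `w`, hence the use of `d² ≤ d` on `[0, 1]`. -/
lemma clearedQuadratic_pos {p d : ℝ} (hp0 : 0 ≤ p) (hd0 : 0 ≤ d) (hd1 : d ≤ 1) :
    0 < clearedQuadratic (p + 2) (4.4 + 0.18 * d) 9.7 := by
  have hd2 : d ^ 2 ≤ d := by nlinarith
  rw [clearedQuadratic]
  linarith [mul_nonneg hp0 (sub_nonneg.2 hd2), mul_nonneg (pow_nonneg hp0 2) (sub_nonneg.2 hd2),
    mul_nonneg (pow_nonneg hp0 3) (sub_nonneg.2 hd2), mul_nonneg hp0 hd0,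
    mul_nonneg (pow_nonneg hp0 2) hd0, mul_nonneg (pow_nonneg hp0 3) hd0,
    mul_nonneg hp0 (sub_nonneg.2 hd1), mul_nonneg (pow_nonneg hp0 2) (sub_nonneg.2 hd1),
    mul_nonneg (pow_nonneg hp0 3) (sub_nonneg.2 hd1),
    pow_nonneg hp0 2, pow_nonneg hp0 3]

lemma const_neg {m u v : ℝ} (hm : 2 ≤ m) (h2 : -u * (m + 5) ≤ 4.58)
    (hv : 2 * v * ((m + 8) * (m + 10)) =
      -210 - 30 * (m + 10) * u - (m + 8) * (m + 10) * u ^ 2) : v < 0 := by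
  obtain ⟨p, hp⟩ : ∃ p, p = m - 2 := ⟨_, rfl⟩
  obtain ⟨t, ht⟩ : ∃ t, t = 4.58 - -u * (m + 5) := ⟨_, rfl⟩
  have hp0 : 0 ≤ p := by linarith
  have ht0 : 0 ≤ t := by linarith
  have hm' : m = p + 2 := by linarith
  have hw : u * (m + 5) = t - 4.58 := by linarith
  have h3 : 2 * v * ((m + 8) * (m + 10)) * (m + 5) ^ 2 =
      -(210 * (m + 5) ^ 2 + 30 * (m + 10) * (m + 5) * (t - 4.58)
        + (m + 8) * (m + 10) * (t - 4.58) ^ 2) := by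
    rw [hv, ← hw]; ring
  have h4 : 0 < 210 * (m + 5) ^ 2 + 30 * (m + 10) * (m + 5) * (t - 4.58)
      + (m + 8) * (m + 10) * (t - 4.58) ^ 2 := by
    rw [hm']
    ring_nf
    positivity
  by_contra hc
  have hc' := not_lt.1 hc
  have : 0 ≤ 2 * v * ((m + 8) * (m + 10)) * (m + 5) ^ 2 := by positivity
  linarith

/-- For `v < 0` the function `r + u + v / r` increases on `r > 0`; the product `(r - s)(s r - v)`
expresses this without division. -/
lemma le_root_of_neg {u v r s : ℝ} (hv : v < 0) (hr : 0 < r) (hs : 0 ≤ s)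
    (hq : s ^ 2 + u * s + v = 0) (h : r ^ 2 + u * r + v < 0) : r ≤ s := by
  by_contra hc
  have h5 : 0 < (r - s) * (s * r - v) :=
    mul_pos (by linarith) (by linarith [mul_nonneg hs hr.le])
  have : (r - s) * (s * r - v) = s * (r ^ 2 + u * r + v) - r * (s ^ 2 + u * s + v) := by ring
  rw [this, hq] at h5
  linarith [mul_nonneg hs (neg_nonneg.2 h.le)]

lemma root_le_of_pos {u v r s : ℝ} (hv : v < 0) (hr : 0 < r) (hs : 0 ≤ s)
    (hq : s ^ 2 + u * s + v = 0) (h : 0 < r ^ 2 + u * r + v) : s ≤ r := by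
  by_contra hc
  have h5 : 0 < (s - r) * (s * r - v) :=
    mul_pos (by linarith) (by linarith [mul_nonneg hs hr.le])
  have : (s - r) * (s * r - v) = r * (s ^ 2 + u * s + v) - s * (r ^ 2 + u * r + v) := by ring
  rw [this, hq] at h5
  linarith [mul_nonneg hs h.le]

/-- In the main range of `u` the non-negative root of `s² + u s + v` is close to `9.6 / (m + 10)`. -/
lemma root_mem_Icc {m u v s : ℝ} (hm : 2 ≤ m) (h1 : 4.4 ≤ -u * (m + 5))
    (h2 : -u * (m + 5) ≤ 4.58)
    (hv : 2 * v * ((m + 8) * (m + 10)) =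
      -210 - 30 * (m + 10) * u - (m + 8) * (m + 10) * u ^ 2)
    (hs : 0 ≤ s) (hq : s ^ 2 + u * s + v = 0) :
    9.4 ≤ s * (m + 10) ∧ s * (m + 10) ≤ 9.7 := by
  have hv0 := const_neg hm h2 hv
  have hscaled := clearedQuadratic_eq hm hv
  obtain ⟨d, hd⟩ : ∃ d, d = (-u * (m + 5) - 4.4) / 0.18 := ⟨_, rfl⟩
  have hd0 : 0 ≤ d := by rw [hd]; apply div_nonneg <;> linarith
  have hd1 : d ≤ 1 := by rw [hd, div_le_one (by norm_num)]; linarith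
  have hwd : -u * (m + 5) = 4.4 + 0.18 * d := by rw [hd]; ring
  have hneg := clearedQuadratic_neg (sub_nonneg.2 hm) hd1
  have hpos := clearedQuadratic_pos (sub_nonneg.2 hm) hd0 hd1
  rw [sub_add_cancel, ← hwd, hscaled] at hneg hpos
  have hm10 : 0 < m + 10 := by linarith
  rw [← div_le_iff₀ hm10, ← le_div_iff₀ hm10]
  have hc : 0 ≤ 2 * (m + 8) * (m + 10) ^ 2 * (m + 5) ^ 2 := by positivity
  exact ⟨le_root_of_neg hv0 (by positivity) hs hq (neg_of_mul_neg_right hneg hc),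
    root_le_of_pos hv0 (by positivity) hs hq (pos_of_mul_pos_right hpos hc)⟩

/-! ### Positivity of `P₈ - ρ P₆` -/

/-- The ratio `P₈(1) / P₆(1)`. -/
noncomputable def valueRatio (m : ℝ) : ℝ := (m + 5) * (m + 4) / ((m + 10) * (m + 12))

lemma monic8_one {m : ℝ} (hm : 2 ≤ m) : monic8 m 1 - valueRatio m * monic6 m 1 = 0 := by
  rw [monic8, monic6, valueRatio]
  field_simp
  ring

lemma monic8_sub_pos {m s : ℝ} (hm : 2 ≤ m) (h1 : 9.4 ≤ s * (m + 10)) (h2 : s * (m + 10) ≤ 9.7) :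
    0 < monic8 m s - valueRatio m * monic6 m s := by
  obtain ⟨p, hp⟩ : ∃ p, p = m - 2 := ⟨_, rfl⟩
  obtain ⟨σ, hσ⟩ : ∃ σ, σ = s * (m + 10) := ⟨_, rfl⟩
  obtain ⟨d, hd⟩ : ∃ d, d = (σ - 9.4) / 0.3 := ⟨_, rfl⟩
  have hp0 : 0 ≤ p := by linarith
  have hd0 : 0 ≤ d := by rw [hd]; apply div_nonneg <;> linarith
  have hd1 : d ≤ 1 := by rw [hd, div_le_one (by norm_num)]; linarith
  have hσd : σ = 9.4 + 0.3 * d := by rw [hd]; ring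
  have hm' : m = p + 2 := by linarith
  have hs : s = σ / (m + 10) := by rw [hσ]; field_simp
  have hs1 : s < 1 := by
    rw [hs, div_lt_one (by linarith)]
    linarith
  -- A Christoffel–Darboux type factorization: `P₈ - ρ P₆` is `s - 1` times the `P₆` of dimension `m
  -- + 2`.
  have hfac : (monic8 m s - valueRatio m * monic6 m s) * ((m + 6) * (m + 8) * (m + 10) ^ 3) =
      (s - 1) * ((σ ^ 3 - 15 * σ ^ 2) * (m + 8) * (m + 6) + 45 * σ * (m + 10) * (m + 6)
        - 15 * (m + 10) ^ 2) := by
    rw [monic8, monic6, valueRatio, hs]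
    field_simp
    ring
  have hK : (σ ^ 3 - 15 * σ ^ 2) * (m + 8) * (m + 6) + 45 * σ * (m + 10) * (m + 6)
        - 15 * (m + 10) ^ 2 < 0 := by
    have hd2 : d ^ 2 ≤ 1 := by nlinarith
    have hd3 : d ^ 3 ≤ 1 := pow_le_one₀ hd0 hd1
    rw [hm', hσd]
    linarith [mul_nonneg hp0 (sub_nonneg.2 hd1), mul_nonneg (pow_nonneg hp0 2) (sub_nonneg.2 hd1),
      mul_nonneg hp0 (sub_nonneg.2 hd2), mul_nonneg (pow_nonneg hp0 2) (sub_nonneg.2 hd2),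
      mul_nonneg hp0 (sub_nonneg.2 hd3), mul_nonneg (pow_nonneg hp0 2) (sub_nonneg.2 hd3),
      pow_nonneg hp0 2]
  have hprod := mul_pos_of_neg_of_neg (sub_neg.2 hs1) hK
  rw [← hfac] at hprod
  exact pos_of_mul_pos_left hprod (by positivity)

/-! ### Exceptional roots for `n = 2, 3, 4` -/

lemma IsSquare86.card_two {g c u v : ℝ} (h : IsSquare86 2 g c u v)
    (hw : 4.58 < -u * (2 + 5)) {N : ℕ} (hN1 : 1 ≤ N) (hc : 0 < c)
    (hN : N * c = (1 + u + v) ^ 2) : N = 2 ∧ u = -1 ∧ v = 1 / 8 := by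
  have hcub := h.cubic_eq le_rfl
  have hv := h.const_eq le_rfl
  have h0 := h.coeff0
  have h3 := h.coeff3
  norm_num at hcub hv h0 h3
  have hfac : (u + 1) * ((u + 1) ^ 2 - 1 / 8) = 0 := by linear_combination hcub / 960
  have hg : g = 2 * u + 2 := by linear_combination h3
  rcases mul_eq_zero.1 hfac with hu | hu
  · have hu : u = -1 := by linarith
    subst hu
    have hv' : v = 1 / 8 := by linarith
    have hc' : c = 1 / 128 := by rw [hg, hv'] at h0; norm_num at h0; linarith
    rw [hc', hv'] at hN
    refine ⟨?_, rfl, hv'⟩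
    have : (N : ℝ) = 2 := by linarith
    exact_mod_cast this
  -- The root `-1 + 1/√8` is excluded by `hw`; at `-1 - 1/√8` one finds `(1 + u + v)² < c`, so `N <
  -- 1`.
  · exfalso
    have hv' : v = -7 / 16 - u / 2 := by linarith
    have hu1 : u < -1.35 := by
      by_contra hcon
      nlinarith
    have hu2 : -1.36 < u := by
      by_contra hcon
      nlinarith
    rw [hg, hv'] at h0
    rw [hv'] at hN
    have : (1 : ℝ) ≤ N := by exact_mod_cast hN1
    nlinarith

lemma IsSquare86.card_four {g c u v : ℝ} (h : IsSquare86 4 g c u v)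
    (hw : 4.58 < -u * (4 + 5)) {N : ℕ}
    (hN : N * c = (1 + u + v) ^ 2) : N = 2 ∧ u = -1 ∧ v = 1 / 8 := by
  have hcub := h.cubic_eq (by norm_num)
  have hv := h.const_eq (by norm_num)
  have h0 := h.coeff0
  have h3 := h.coeff3
  norm_num at hcub hv h0 h3
  have hfac : (u + 1) ^ 2 * (2 * u + 1) = 0 := by linear_combination hcub / 840
  have hg : g = 2 * u + 7 / 4 := by linear_combination h3
  rcases mul_eq_zero.1 hfac with hu | hu
  · have hu : u = -1 := by
      have := pow_eq_zero_iff (two_ne_zero) |>.1 hu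
      linarith
    subst hu
    have hv' : v = 1 / 8 := by linarith
    have hc' : c = 1 / 128 := by rw [hg, hv'] at h0; norm_num at h0; linarith
    rw [hc', hv'] at hN
    refine ⟨?_, rfl, hv'⟩
    have : (N : ℝ) = 2 := by linarith
    exact_mod_cast this
  · linarith

/-- The third root, about `-0.565`, belongs to the main range and is cut off by `hw`. -/
lemma cubic_three_root_mem {u : ℝ} (h : 429 * u ^ 3 + 1170 * u ^ 2 + 1020 * u + 280 = 0)
    (hw : u < -0.57) : (-1.192 < u ∧ u < -1.18) ∨ (-0.9722 < u ∧ u < -0.9721) := by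
  have hlow : -1.192 < u := by
    by_contra hcon
    have : 0 ≤ -1.192 - u := by linarith
    linarith [pow_nonneg this 2, pow_nonneg this 3]
  rcases lt_or_ge u (-1.18) with hu | hu
  · exact Or.inl ⟨hlow, hu⟩
  · refine Or.inr ⟨?_, ?_⟩
    · by_contra hcon
      have h1 : 0 ≤ u + 1.18 := by linarith
      have h2 : 0 ≤ -0.9722 - u := by linarith
      nlinarith [mul_nonneg h1 h2, mul_nonneg (mul_nonneg h1 h2) h1]
    · by_contra hcon
      have h1 : 0 ≤ u + 0.9721 := by linarith
      have h2 : 0 ≤ -0.57 - u := by linarith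
      nlinarith [mul_nonneg h1 h2, mul_nonneg (mul_nonneg h1 h2) h1]

lemma IsSquare86.false_of_three {g c u v : ℝ} (h : IsSquare86 3 g c u v)
    (hw : 4.58 < -u * (3 + 5)) {N : ℕ} (hN1 : 1 ≤ N) (hc : 0 < c)
    (hN : N * c = (1 + u + v) ^ 2) : False := by
  have hcub := h.cubic_eq (by norm_num)
  have hv := h.const_eq (by norm_num)
  have h0 := h.coeff0
  have h3 := h.coeff3
  norm_num at hcub hv h0 h3
  have hg : g = 2 * u + 28 / 15 := by linear_combination h3
  rw [hg] at h0
  have hcub' : 429 * u ^ 3 + 1170 * u ^ 2 + 1020 * u + 280 = 0 := by linear_combination hcub / 3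
  have hv' : v = -105 / 143 - 15 / 11 * u - u ^ 2 / 2 := by linarith
  have hc' : c = v ^ 2 + 5 / 231 * (2 * u + 28 / 15) - 1 / 143 * (7 / 9) := by linarith
  -- At the first root `N < 1`; at the second `3 < N < 4`.
  rcases cubic_three_root_mem hcub' (by linarith) with ⟨hlow, hu⟩ | ⟨hu2, hu1⟩
  · have hv1 : v < 0.19 := by rw [hv']; nlinarith
    have hv2 : 0.17 < v := by rw [hv']; nlinarith
    have h1 : (1 : ℝ) ≤ N := by exact_mod_cast hN1
    have hF : (1 + u + v) ^ 2 < 0.001 := by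
      have h2 : -0.03 < 1 + u + v := by linarith
      have h3 : 1 + u + v < 0.03 := by linarith
      linarith [mul_pos (by linarith : 0 < 0.03 + (1 + u + v))
        (by linarith : 0 < 0.03 - (1 + u + v))]
    have hc1 : 0.01 < c := by rw [hc']; nlinarith
    linarith [mul_le_mul_of_nonneg_right h1 hc.le]
  · have hv1 : v < 0.1189 := by rw [hv']; nlinarith
    have hv2 : 0.1188 < v := by rw [hv']; nlinarith
    have hp1 : 0.1466 < 1 + u + v := by linarith
    have hp2 : 1 + u + v < 0.1468 := by linarith
    have hF1 : (1 + u + v) ^ 2 < 0.0217 := by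
      linarith [mul_pos (by linarith : 0 < 1 + u + v) (sub_pos.2 hp2)]
    have hF2 : 0.0214 < (1 + u + v) ^ 2 := by
      linarith [mul_pos (by linarith : 0 < 1 + u + v) (sub_pos.2 hp1)]
    have hvv1 : v ^ 2 < 0.1189 * 0.1189 := by
      linarith [mul_pos (by linarith : 0 < v) (sub_pos.2 hv1)]
    have hvv2 : 0.1188 * 0.1188 < v ^ 2 := by
      linarith [mul_pos (by linarith : 0 < v) (sub_pos.2 hv2)]
    have hc1 : c < 0.0071 := by rw [hc']; linarith
    have hc2 : 0.0069 < c := by rw [hc']; linarith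
    have h3 : (3 : ℝ) < N := by
      by_contra hcon
      linarith [mul_le_mul_of_nonneg_right (not_lt.1 hcon) hc.le]
    have h4 : (N : ℝ) < 4 := by
      by_contra hcon
      linarith [mul_le_mul_of_nonneg_right (not_lt.1 hcon) hc.le]
    have h3' : 3 < N := by exact_mod_cast h3
    have h4' : N < 4 := by exact_mod_cast h4
    omega

/-- A system of two vectors cannot occur in the exceptional cases `u = -1`, `v = 1 / 8`. -/
lemma monic6_one_add_ne_zero {m s : ℝ} (hm : m = 2 ∨ m = 4) (hs : s ^ 2 + -1 * s + 1 / 8 = 0) :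
    monic6 m 1 + monic6 m s ≠ 0 := by
  intro h
  have h3 : s ^ 3 = 7 / 8 * s - 1 / 8 := by linear_combination (s + 1) * hs
  have h2 : s ^ 2 = s - 1 / 8 := by linarith
  rcases hm with rfl | rfl
  · rw [monic6, monic6, h3, h2] at h
    norm_num at h
    have hs' : s = 1 := by linarith
    rw [hs'] at hs
    norm_num at hs
  · rw [monic6, monic6, h3, h2] at h
    norm_num at h
    linarith

/-! ### Contradiction from a square form -/

/-- There is no design of harmonic index `{8, 6}` whose size is the bound
given by a square form. -/
theorem IsSquare86.not_isDesign {n : ℕ} (hn : 2 ≤ n) {g c u v : ℝ} (h : IsSquare86 n g c u v)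
    {Y : Finset (EuclideanSpace ℝ (Fin n))} (hY : IsDesign {8, 6} Y) (hc : c ≠ 0)
    (hN : Y.card * c = (1 + u + v) ^ 2) : False := by
  have hm : (2 : ℝ) ≤ n := by exact_mod_cast hn
  have hN1 : 1 ≤ Y.card := hY.nonempty.card_pos
  have hc0 : 0 < c := by
    refine lt_of_le_of_ne ?_ hc.symm
    have h1 : (0 : ℝ) < Y.card := by exact_mod_cast hN1
    exact nonneg_of_mul_nonneg_right (hN ▸ sq_nonneg _) h1
  obtain ⟨x, hx⟩ := hY.nonempty
  have hx1 := hY.unit x hx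
  have hxx : (inner ℝ x x : ℝ) ^ 2 = 1 := by rw [real_inner_self_eq_norm_sq, hx1]; norm_num
  have s6 := hY.sum_monic6 (by simp) hx1
  have s8 := hY.sum_monic8 (by simp) hx1
  have hF : ∑ y ∈ Y, (((inner ℝ x y : ℝ) ^ 2) ^ 2 + u * inner ℝ x y ^ 2 + v) ^ 2
      = (1 + u + v) ^ 2 := by
    rw [Finset.sum_congr rfl fun y _ => (h.eval_eq (inner ℝ x y ^ 2)).symm,
      Finset.sum_add_distrib, Finset.sum_add_distrib, ← Finset.mul_sum, s6, s8, Finset.sum_const,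
      nsmul_eq_mul, hN]
    ring
  classical
  rw [← Finset.add_sum_erase _ _ hx, hxx] at s6 s8 hF
  have hzero : ∀ y ∈ Y.erase x,
      ((inner ℝ x y : ℝ) ^ 2) ^ 2 + u * inner ℝ x y ^ 2 + v = 0 := by
    have h1 : ∑ y ∈ Y.erase x, (((inner ℝ x y : ℝ) ^ 2) ^ 2 + u * inner ℝ x y ^ 2 + v) ^ 2 = 0 := by
      linarith
    intro y hy
    exact pow_eq_zero_iff two_ne_zero |>.1
      ((Finset.sum_eq_zero_iff_of_nonneg fun _ _ => sq_nonneg _).1 h1 y hy)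
  have hcub := h.cubic_eq hm
  have hv := h.const_eq hm
  have hlow := neg_mul_add_five_ge hm hcub
  rcases le_or_gt (-u * ((n : ℝ) + 5)) 4.58 with hhigh | hhigh
  -- A one-point design would force `P₆(1) = 0`.
  · have hne : (Y.erase x).Nonempty := by
      by_contra hemp
      rw [Finset.not_nonempty_iff_eq_empty.1 hemp, Finset.sum_empty, add_zero, monic6] at s6
      field_simp at s6
      nlinarith [mul_nonneg (sub_nonneg.2 hm) (sub_nonneg.2 hm)]
    have hpos : 0 < ∑ y ∈ Y.erase x, (monic8 n (inner ℝ x y ^ 2)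
        - valueRatio n * monic6 n (inner ℝ x y ^ 2)) := by
      refine Finset.sum_pos (fun y hy => ?_) hne
      obtain ⟨h1, h2⟩ := root_mem_Icc hm hlow hhigh hv (sq_nonneg _) (hzero y hy)
      exact monic8_sub_pos hm h1 h2
    rw [Finset.sum_sub_distrib, ← Finset.mul_sum] at hpos
    exact hpos.ne' (by linear_combination s8 - valueRatio n * s6 - monic8_one hm)
  · have htwo : Y.card = 2 ∧ u = -1 ∧ v = 1 / 8 ∧ ((n : ℝ) = 2 ∨ (n : ℝ) = 4) := by
      have hlt : n < 5 := by
        by_contra hcon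
        have : (5 : ℝ) ≤ n := by exact_mod_cast not_lt.1 hcon
        linarith [neg_mul_add_five_le this hcub]
      interval_cases n
      · obtain ⟨h1, h2, h3⟩ := IsSquare86.card_two (by exact_mod_cast h) (by exact_mod_cast hhigh)
          hN1 hc0 hN
        exact ⟨h1, h2, h3, by norm_num⟩
      · exact (IsSquare86.false_of_three (by exact_mod_cast h) (by exact_mod_cast hhigh)
          hN1 hc0 hN).elim
      · obtain ⟨h1, h2, h3⟩ := IsSquare86.card_four (by exact_mod_cast h) (by exact_mod_cast hhigh)
          hN
        exact ⟨h1, h2, h3, by norm_num⟩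
    obtain ⟨h1, rfl, rfl, h2⟩ := htwo
    obtain ⟨y, hy⟩ := Finset.card_eq_one.1 (by rw [Finset.card_erase_of_mem hx, h1] :
      (Y.erase x).card = 1)
    rw [hy, Finset.sum_singleton] at s6
    exact monic6_one_add_ne_zero h2 (hzero y (by rw [hy]; simp)) s6

/-! ### From the two notions of tightness to a real square -/

/-- The values at `0, …, 4` suffice; the multipliers are the rows of the inverse Vandermonde matrix
at the nodes `k²`. -/
lemma even_coeffs_eq_zero {K : Type*} [Field K] [CharZero K] {e0 e1 e2 e3 e4 : K}
    (h : ∀ k : ℕ, e4 * (k : K) ^ 8 + e3 * (k : K) ^ 6 + e2 * (k : K) ^ 4 + e1 * (k : K) ^ 2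
      + e0 = 0) :
    e0 = 0 ∧ e1 = 0 ∧ e2 = 0 ∧ e3 = 0 ∧ e4 = 0 := by
  have h0 := h 0
  have h1 := h 1
  have h2 := h 2
  have h3 := h 3
  have h4 := h 4
  push_cast at h0 h1 h2 h3 h4
  refine ⟨?_, ?_, ?_, ?_, ?_⟩
  · linear_combination (1) * h0
  · linear_combination (-205/144) * h0 + (8/5) * h1 + (-1/5) * h2 + (8/315) * h3 + (-1/560) * h4
  · linear_combination (91/192) * h0 + (-61/90) * h1 + (169/720) * h2 + (-1/30) * h3 + (7/2880) * h4
  · linear_combination (-5/96) * h0 + (29/360) * h1 + (-13/360) * h2 + (1/120) * h3 + (-1/1440) * h4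
  · linear_combination (1/576) * h0 + (-1/360) * h1 + (1/720) * h2 + (-1/2520) * h3 + (1/20160) * h4

lemma leading8_pos {n : ℕ} (hn : 2 ≤ n) : 0 < leading8 n := by
  have : (0 : ℝ) < n := by exact_mod_cast (by omega : 0 < n)
  rw [leading8]
  positivity

/-- The coefficient of `P₆` after dividing `Q_{n,8} + f₆ Q_{n,6}` by the leading coefficient. -/
noncomputable def scaledCoeff (n : ℕ) (f₆ : ℝ) : ℝ := f₆ * leading6 n / leading8 n

lemma eval_combination86 {n : ℕ} (hn : 2 ≤ n) (f₆ x : ℝ) :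
    (combination86 n f₆).eval x =
      leading8 n * (monic8 n (x ^ 2) + scaledCoeff n f₆ * monic6 n (x ^ 2)) := by
  have h8 := (leading8_pos hn).ne'
  obtain ⟨e6, e8⟩ := eval_gegenbauer_six_eight hn x
  rw [combination86, eval_add, eval_mul, eval_C, e6, e8, scaledCoeff]
  field_simp

lemma HasSquareForm86.isSquare86 {n : ℕ} (hn : 2 ≤ n) {f₆ c : ℝ} (h : HasSquareForm86 n f₆ c) :
    ∃ u v, IsSquare86 n (scaledCoeff n f₆) (c / leading8 n) u v := by
  obtain ⟨a, α, β, h⟩ := h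
  have h8 := (leading8_pos hn).ne'
  have hm : (0 : ℝ) < n := by exact_mod_cast (by omega : 0 < n)
  generalize hg : scaledCoeff n f₆ = g
  obtain ⟨A, hA⟩ : ∃ A, A = leading8 n := ⟨_, rfl⟩
  obtain ⟨b3, hb3⟩ : ∃ b, b = -28 / ((n : ℝ) + 12) + g := ⟨_, rfl⟩
  obtain ⟨b2, hb2⟩ : ∃ b, b = 210 / (((n : ℝ) + 12) * (n + 10)) - 15 / ((n : ℝ) + 8) * g := ⟨_, rfl⟩
  obtain ⟨b1, hb1⟩ : ∃ b, b = -420 / (((n : ℝ) + 12) * (n + 10) * (n + 8))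
    + 45 / (((n : ℝ) + 8) * (n + 6)) * g := ⟨_, rfl⟩
  obtain ⟨b0, hb0⟩ : ∃ b, b = 105 / (((n : ℝ) + 12) * (n + 10) * (n + 8) * (n + 6))
    - 15 / (((n : ℝ) + 8) * (n + 6) * (n + 4)) * g := ⟨_, rfl⟩
  have hreal : ∀ x : ℝ, (combination86 n f₆).eval x =
      A * (x ^ 8 + b3 * x ^ 6 + b2 * x ^ 4 + b1 * x ^ 2 + b0) := by
    intro x
    rw [eval_combination86 hn, hg, monic8, monic6, hA, hb3, hb2, hb1, hb0]
    ring
  rw [← hA] at h8 ⊢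
  obtain ⟨U, hU⟩ : ∃ U, U = -(α ^ 2 + β ^ 2) := ⟨_, rfl⟩
  obtain ⟨V, hV⟩ : ∃ V, V = α ^ 2 * β ^ 2 := ⟨_, rfl⟩
  obtain ⟨e0, e1, e2, e3, e4⟩ := even_coeffs_eq_zero (K := ℂ) (e4 := A - a) (e3 := A * b3 - a * (2 * U))
      (e2 := A * b2 - a * (U ^ 2 + 2 * V)) (e1 := A * b1 - a * (2 * U * V))
      (e0 := A * b0 + c - a * V ^ 2) (by
    intro k
    have hk := congrArg (eval ((k : ℝ) : ℂ)) h
    rw [eval_map_algebraMap, show (((k : ℝ) : ℂ)) = algebraMap ℝ ℂ k from rfl,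
      aeval_algebraMap_apply_eq_algebraMap_eval, hreal] at hk
    simp only [eval_sub, eval_mul, eval_pow, eval_C, eval_X, Complex.coe_algebraMap] at hk
    push_cast at hk
    rw [hU, hV]
    linear_combination hk)
  have ha : a = A := by
    have : (a : ℂ) = A := by linear_combination -e4
    exact_mod_cast this
  subst ha
  have hac : (a : ℂ) ≠ 0 := by exact_mod_cast h8
  have f3 : (b3 : ℂ) = 2 * U := mul_left_cancel₀ hac (by linear_combination e3)
  have f2 : (b2 : ℂ) = U ^ 2 + 2 * V := mul_left_cancel₀ hac (by linear_combination e2)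
  have f1 : (b1 : ℂ) = 2 * U * V := mul_left_cancel₀ hac (by linear_combination e1)
  -- `α`, `β` may be complex, but the top coefficients determine `U` and `V` rationally, so both are
  -- real.
  have hUr : U = ((b3 / 2 : ℝ) : ℂ) := by push_cast; linear_combination -f3 / 2
  have hVr : V = (((b2 - (b3 / 2) ^ 2) / 2 : ℝ) : ℂ) := by
    rw [hUr] at f2
    push_cast at f2 ⊢
    linear_combination -f2 / 2
  refine ⟨b3 / 2, (b2 - (b3 / 2) ^ 2) / 2, ?_, ?_, ?_, ?_⟩
  · linear_combination -hb3
  · linear_combination -hb2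
  · rw [hUr, hVr] at f1
    rw [← hb1]
    exact_mod_cast f1
  · rw [hVr] at e0
    have e0' : a * b0 + c - a * ((b2 - (b3 / 2) ^ 2) / 2) ^ 2 = 0 := by exact_mod_cast e0
    rw [← hb0]
    apply mul_left_cancel₀ h8
    rw [mul_add, mul_div_cancel₀ _ h8]
    linear_combination e0'

lemma card_mul_eq {n : ℕ} (hn : 2 ≤ n) {Y : Finset (EuclideanSpace ℝ (Fin n))}
    (hY : Y.Nonempty) {f₆ c : ℝ} (hN : (Y.card : ℝ) = fisherBound (combination86 n f₆) c) :
    c / leading8 n ≠ 0 ∧ Y.card * (c / leading8 n) =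
      monic8 n 1 + scaledCoeff n f₆ * monic6 n 1 + c / leading8 n := by
  have h8 := (leading8_pos hn).ne'
  -- Division by zero would make the bound `0`, but `Y` is non-empty.
  have hc : c ≠ 0 := by
    rintro rfl
    rw [fisherBound, div_zero] at hN
    exact hY.card_ne_zero (by exact_mod_cast hN)
  refine ⟨div_ne_zero hc h8, ?_⟩
  rw [hN, fisherBound, eval_combination86 hn, one_pow]
  field_simp
  ring

lemma quartic_double_roots {e3 e2 e1 e0 a b : ℝ} (hab : a ≠ b)
    (ha : a ^ 4 + e3 * a ^ 3 + e2 * a ^ 2 + e1 * a + e0 = 0)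
    (hb : b ^ 4 + e3 * b ^ 3 + e2 * b ^ 2 + e1 * b + e0 = 0)
    (ha' : 4 * a ^ 3 + 3 * e3 * a ^ 2 + 2 * e2 * a + e1 = 0)
    (hb' : 4 * b ^ 3 + 3 * e3 * b ^ 2 + 2 * e2 * b + e1 = 0) :
    e3 = 2 * -(a + b) ∧ e2 = (-(a + b)) ^ 2 + 2 * (a * b) ∧ e1 = 2 * -(a + b) * (a * b) ∧
      e0 = (a * b) ^ 2 := by
  have hne : b - a ≠ 0 := sub_ne_zero.2 hab.symm
  have h3 : e3 = 2 * -(a + b) := by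
    apply mul_left_cancel₀ (pow_ne_zero 3 hne)
    -- The trapezoidal rule for the derivative of the quartic is exact on quadratics, so only `e3`
    -- and the quartic term survive.
    linear_combination 2 * ha - 2 * hb + (b - a) * (ha' + hb')
  have h2 : e2 = (-(a + b)) ^ 2 + 2 * (a * b) := by
    apply mul_left_cancel₀ (pow_ne_zero 2 hne)
    rw [h3] at ha hb ha'
    linear_combination hb - ha - (b - a) * ha'
  have h1 : e1 = 2 * -(a + b) * (a * b) := by
    rw [h3, h2] at ha'
    linear_combination ha'
  refine ⟨h3, h2, h1, ?_⟩
  rw [h3, h2, h1] at ha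
  linear_combination ha

lemma deriv_quartic_eq_zero {e3 e2 e1 e0 a : ℝ} (ha : a ∈ Set.Ioo (0 : ℝ) 1)
    (h0 : a ^ 4 + e3 * a ^ 3 + e2 * a ^ 2 + e1 * a + e0 = 0)
    (hpos : ∀ s ∈ Set.Icc (0 : ℝ) 1, 0 ≤ s ^ 4 + e3 * s ^ 3 + e2 * s ^ 2 + e1 * s + e0) :
    4 * a ^ 3 + 3 * e3 * a ^ 2 + 2 * e2 * a + e1 = 0 := by
  have hd : HasDerivAt (fun s : ℝ => s ^ 4 + e3 * s ^ 3 + e2 * s ^ 2 + e1 * s + e0)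
      (4 * a ^ 3 + 3 * e3 * a ^ 2 + 2 * e2 * a + e1) a := by
    have := (((((hasDerivAt_pow 4 a).add ((hasDerivAt_pow 3 a).const_mul e3)).add
      ((hasDerivAt_pow 2 a).const_mul e2)).add ((hasDerivAt_id a).const_mul e1)).add_const e0)
    exact this.congr_deriv (by push_cast; ring)
  refine IsLocalMin.hasDerivAt_eq_zero ?_ hd
  filter_upwards [Icc_mem_nhds ha.1 ha.2] with s hs
  rw [h0]
  exact hpos s hs

lemma square_of_zeros {m g c a b : ℝ} (ha : a ∈ Set.Ioo (0 : ℝ) 1) (hb : b ∈ Set.Ioo (0 : ℝ) 1)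
    (hab : a ≠ b) (ha0 : monic8 m a + g * monic6 m a + c = 0)
    (hb0 : monic8 m b + g * monic6 m b + c = 0)
    (hpos : ∀ s ∈ Set.Icc (0 : ℝ) 1, 0 ≤ monic8 m s + g * monic6 m s + c) :
    IsSquare86 m g c (-(a + b)) (a * b) := by
  have key : ∀ s, monic8 m s + g * monic6 m s + c =
      s ^ 4 + (-28 / (m + 12) + g) * s ^ 3
        + (210 / ((m + 12) * (m + 10)) - 15 / (m + 8) * g) * s ^ 2
        + (-420 / ((m + 12) * (m + 10) * (m + 8)) + 45 / ((m + 8) * (m + 6)) * g) * s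
        + (105 / ((m + 12) * (m + 10) * (m + 8) * (m + 6))
          - 15 / ((m + 8) * (m + 6) * (m + 4)) * g + c) := by
    intro s
    rw [monic8, monic6]
    ring
  simp only [key] at ha0 hb0 hpos
  obtain ⟨h3, h2, h1, h0⟩ := quartic_double_roots hab ha0 hb0
    (deriv_quartic_eq_zero ha ha0 hpos) (deriv_quartic_eq_zero hb hb0 hpos)
  exact ⟨h3, h2, h1, h0⟩

/-- The minimum of `P₈ + g P₆` on `[0, 1]` is negative and is not attained at `0`. -/
lemma not_zero_of_min {m g c : ℝ} (hm : 2 ≤ m) (hc : 0 < c)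
    (h0 : monic8 m 0 + g * monic6 m 0 + c = 0)
    (hpos : ∀ s ∈ Set.Icc (0 : ℝ) 1, 0 ≤ monic8 m s + g * monic6 m s + c) : False := by
  rcases lt_or_ge g 0 with hg | hg
  · have h8 : 0 < monic8 m 0 := by
      have : monic8 m 0 = 105 / ((m + 12) * (m + 10) * (m + 8) * (m + 6)) := by rw [monic8]; ring
      rw [this]
      positivity
    have h6 : monic6 m 0 < 0 := by
      have : monic6 m 0 = -(15 / ((m + 8) * (m + 6) * (m + 4))) := by rw [monic6]; ring
      rw [this, neg_lt_zero]
      positivity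
    linarith [mul_pos_of_neg_of_neg hg h6]
  -- For `g ≥ 0` the point `9 / (m + 10)` gives a smaller value than `0` does.
  · have hs : 9 / (m + 10) ∈ Set.Icc (0 : ℝ) 1 := by
      refine ⟨by positivity, ?_⟩
      rw [div_le_one (by linarith)]
      linarith
    have h6 : monic6 m (9 / (m + 10)) - monic6 m 0 ≤ 0 := by
      have : monic6 m (9 / (m + 10)) - monic6 m 0 =
          -(81 * ((m - 2) * (m + 16)) / ((m + 6) * (m + 8) * (m + 10) ^ 3)) := by
        rw [monic6, monic6]
        field_simp
        ring
      rw [this, neg_nonpos]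
      have : 0 ≤ m - 2 := by linarith
      positivity
    have h8 : monic8 m (9 / (m + 10)) - monic8 m 0 < 0 := by
      have : monic8 m (9 / (m + 10)) - monic8 m 0 =
          -(9 * (69 * (m - 2) ^ 2 + 900 * (m - 2) + 3780)
            / ((m + 8) * (m + 12) * (m + 10) ^ 4)) := by
        rw [monic8, monic8]
        field_simp
        ring
      rw [this, neg_lt_zero]
      have : 0 ≤ m - 2 := by linarith
      positivity
    have := hpos _ hs
    linarith [mul_nonneg hg (neg_nonneg.2 h6)]

theorem not_isSquareFormTight86 {n : ℕ} (hn : 2 ≤ n) {Y : Finset (EuclideanSpace ℝ (Fin n))} :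
    ¬ IsSquareFormTight86 Y := by
  rintro ⟨hY, f₆, c, hF, hN⟩
  obtain ⟨u, v, h⟩ := hF.isSquare86 hn
  obtain ⟨hc, hcard⟩ := card_mul_eq hn hY.nonempty hN
  refine h.not_isDesign hn hY hc ?_
  rw [hcard, h.eval_eq]
  ring

theorem not_isTight {n : ℕ} (hn : 2 ≤ n) {Y : Finset (EuclideanSpace ℝ (Fin n))} :
    ¬ IsTight {8, 6} Y := by
  rintro ⟨hY, f, c, ⟨hlead, hleast, hncard⟩, hN⟩
  have hm : (2 : ℝ) ≤ n := by exact_mod_cast hn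
  have hA := leading8_pos hn
  have hf8 : f 8 = 1 := hlead 8 (by simp) (by simp)
  have hcomb : combination n {8, 6} f = combination86 n (f 6) := by
    rw [combination, Finset.sum_pair (by norm_num), hf8, combination86, C_1, one_mul]
  rw [hcomb] at hleast hncard hN
  obtain ⟨hc, hcard⟩ := card_mul_eq hn hY.nonempty hN
  have heval : ∀ x : ℝ, (combination86 n (f 6)).eval x + c = leading8 n *
      (monic8 n (x ^ 2) + scaledCoeff n (f 6) * monic6 n (x ^ 2) + c / leading8 n) := by
    intro x
    rw [eval_combination86 hn]
    field_simp
  generalize scaledCoeff n (f 6) = g at *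
  generalize hd : c / leading8 n = d at *
  have hpos : ∀ s ∈ Set.Icc (0 : ℝ) 1, 0 ≤ monic8 n s + g * monic6 n s + d := by
    intro s hs
    have hle := hleast.2 ⟨√s, ⟨by linarith [Real.sqrt_nonneg s], Real.sqrt_le_one.2 hs.2⟩, rfl⟩
    have h1 := heval √s
    rw [Real.sq_sqrt hs.1] at h1
    refine nonneg_of_mul_nonneg_right ?_ hA
    rw [← h1]
    linarith
  have hNpos : (0 : ℝ) < Y.card := by exact_mod_cast hY.nonempty.card_pos
  have hone : monic8 n 1 + g * monic6 n 1 + d ≠ 0 := by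
    rw [← hcard]
    exact mul_ne_zero hNpos.ne' hc
  have hd0 : 0 < d := by
    refine lt_of_le_of_ne ?_ hc.symm
    refine nonneg_of_mul_nonneg_right ?_ hNpos
    rw [hcard]
    exact hpos 1 (by simp)
  rw [Finset.card_pair (by norm_num), Set.ncard_eq_two] at hncard
  obtain ⟨x, y, hxy, hset⟩ := hncard
  have hmem : ∀ z, z ∈ ({x, y} : Set ℝ) → 0 ≤ z ∧ z ^ 2 ∈ Set.Ioo (0 : ℝ) 1 ∧
      monic8 n (z ^ 2) + g * monic6 n (z ^ 2) + d = 0 := by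
    intro z hz
    rw [← hset] at hz
    obtain ⟨⟨hz0, hz1⟩, hz⟩ := hz
    have h1 := heval z
    rw [hz, neg_add_cancel, eq_comm, mul_eq_zero, or_iff_right hA.ne'] at h1
    -- Only interior minima in `s = z²` force double roots, so both endpoints must be excluded; at
    -- `1` the value is `|Y| d ≠ 0`.
    have hz0' : z ≠ 0 := by
      rintro rfl
      rw [zero_pow two_ne_zero] at h1
      exact not_zero_of_min hm hd0 h1 hpos
    have hz1' : z ≠ 1 := by
      rintro rfl
      rw [one_pow] at h1
      exact hone h1
    refine ⟨hz0, ⟨by positivity, ?_⟩, h1⟩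
    exact pow_lt_one₀ hz0 (lt_of_le_of_ne hz1 hz1') two_ne_zero
  obtain ⟨hx0, hx, hx'⟩ := hmem x (by simp)
  obtain ⟨hy0, hy, hy'⟩ := hmem y (by simp)
  have hne : x ^ 2 ≠ y ^ 2 := fun h => hxy ((sq_eq_sq₀ hx0 hy0).1 h)
  have h := square_of_zeros hx hy hne hx' hy' hpos
  refine h.not_isDesign hn hY hc ?_
  rw [hcard, h.eval_eq]
  ring

end HarmonicIndex


theorem mainTheorem9 (n : ℕ) (hn : 2 ≤ n) :
    (¬ ∃ Y : Finset (EuclideanSpace ℝ (Fin n)), HarmonicIndex.IsTight {8, 6} Y) ∧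
      ¬ ∃ Y : Finset (EuclideanSpace ℝ (Fin n)), HarmonicIndex.IsSquareFormTight86 Y :=
  ⟨fun ⟨_, hY⟩ => HarmonicIndex.not_isTight hn hY,
    fun ⟨_, hY⟩ => HarmonicIndex.not_isSquareFormTight86 hn hY⟩
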